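/- Let $G$ be a group generated by a finite set $S$, let $l_S(g)$ be the length of a shortest word in $S\cup S^{-1}$ representing $g\in G$, and let $\mu$ be a probability measure on $G$ (all subsets being measurable). Write $\mu^{*n}$ for the $n$-th convolution power of $\mu$ (with $\mu^{*0}$ the point mass at the identity $e$). Assume that $\mu$ is symmetric ($\mu(g^{-1})=\mu(g)$ for all $g\in G$), non-degenerate (the support of $\mu$ generates $G$ as a semigroup) and aperiodic ($\gcd\{n\ge 0:\mu^{*n}(e)>0\}=1$). Then the following three conditions are equivalent. 1. There is a sequence of real numbers $r(n)\to\infty$ such that the distributions of $(G,\mu)$ are almost constant in the neighbourhood of $e$ of radius $r(n)$; that is, for every $\varepsilon>0$ there is $N$ such that for all $n\ge N$ one has $\mu^{*n}(e)>0$ and $$\left|\frac{\mu^{*n}(g)}{\mu^{*n}(e)}-1\right|\le\varepsilon\quad\text{for all } g\in G \text{ with } l_S(g)\le r(n).$$ 2. There is a sequence of real numbers $r(n)\to\infty$ such that the distributions of $(G,\mu)$ are weakly almost constant in the neighbourhood of $e$ of radius $r(n)$; that is, there are $C>0$ and $N$ such that for all $n\ge N$ one has $\mu^{*n}(e)>0$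 and $$\frac1C\le\frac{\mu^{*n}(g)}{\mu^{*n}(e)}\le C\quad\text{for all } g\in G \text{ with } l_S(g)\le r(n).$$ 3. $G$ is amenable, i.e. there is a left-invariant finitely additive probability measure defined on all subsets of $G$. -/

import Mathlib

open MeasureTheory Filter

namespace RandomWalk

variable {G : Type*} [Group G]

/-- The `n`-th convolution power `μ^{*n}`, with `μ^{*0}` the point mass at the identity. -/
noncomputable def convPow [MeasurableSpace G] (μ : Measure G) : ℕ → Measure G
  | 0 => Measure.dirac 1
  | n + 1 => (convPow μ n).mconv μ

/-- The ratio `μ^{*n}(g) / μ^{*n}(e)`. -/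
noncomputable def ratio [MeasurableSpace G] (μ : Measure G) (n : ℕ) (g : G) : ℝ :=
  (convPow μ n).real {g} / (convPow μ n).real {1}

/-- `μ(g⁻¹) = μ(g)` for every `g`. -/
def IsSymmetric [MeasurableSpace G] (μ : Measure G) : Prop :=
  ∀ g : G, μ {g⁻¹} = μ {g}

/-- The support of `μ` generates `G` as a semigroup. -/
def IsNondegenerate [MeasurableSpace G] (μ : Measure G) : Prop :=
  Subsemigroup.closure {g : G | 0 < μ {g}} = ⊤

/-- The period of `μ`: the greatest common divisor of the `n` with `μ^{*n}(e) > 0`. -/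
noncomputable def period [MeasurableSpace G] (μ : Measure G) : ℕ :=
  Nat.setGcd {n : ℕ | 0 < convPow μ n {1}}

def IsAperiodic [MeasurableSpace G] (μ : Measure G) : Prop :=
  period μ = 1

/-- The length of a shortest word in `S ∪ S⁻¹` representing `g` (for `S` generating `G`). -/
noncomputable def wordLength (S : Set G) (g : G) : ℕ :=
  sInf {n : ℕ | ∃ w : List G, (∀ s ∈ w, s ∈ S ∨ s⁻¹ ∈ S) ∧ w.prod = g ∧ w.length = n}

/-- The ratios `μ^{*n}(g) / μ^{*n}(e)` tend to one, uniformly over the elements `g` of length at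
most `r n`. -/
def AlmostConstant [MeasurableSpace G] (S : Set G) (μ : Measure G) (r : ℕ → ℝ) : Prop :=
  ∀ ε : ℝ, 0 < ε → ∀ᶠ n in atTop, ∀ g : G, (wordLength S g : ℝ) ≤ r n →
    |ratio μ n g - 1| ≤ ε

/-- For all large `n` the ratios `μ^{*n}(g) / μ^{*n}(e)`, over the elements `g` of length at most
`r n`, lie between two positive constants. -/
def WeaklyAlmostConstant [MeasurableSpace G] (S : Set G) (μ : Measure G) (r : ℕ → ℝ) : Prop :=
  ∃ C : ℝ, 0 < C ∧ ∀ᶠ n in atTop, ∀ g : G, (wordLength S g : ℝ) ≤ r n →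
    1 / C ≤ ratio μ n g ∧ ratio μ n g ≤ C

end RandomWalk

/-- A discrete group is amenable if it carries a left-invariant finitely additive probability
measure defined on all subsets. -/
def IsAmenableGroup (G : Type*) [Group G] : Prop :=
  ∃ m : Set G → ENNReal, m Set.univ = 1 ∧
    (∀ A B : Set G, Disjoint A B → m (A ∪ B) = m A + m B) ∧
    ∀ (g : G) (A : Set G), m ((fun x => g * x) '' A) = m A

/-!
All three conditions are equivalent to the walk having spectral radius one, in the form
`μ^{*(2n+2)}(e) / μ^{*2n}(e) → 1`.

By symmetry of `μ`, the inner product in `ℓ²(G)` of `μ^{*m}` and a translate of `μ^{*n}` is a value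
of `μ^{*(m+n)}`. Hence `μ^{*2n}(g) ≤ μ^{*2n}(e)`, with difference half the squared `ℓ²` distance
between `μ^{*n}` and its translate by `g`, and by Cauchy–Schwarz the sequence `μ^{*2n}(e)` is
log-convex. So its successive quotients increase to a limit at most one, and a limit `c < 1` means
`μ^{*2n}(e) ≤ c ^ n` (`tendsto_returnQuotient_or_exists_le_pow`).

*Weak almost constancy gives spectral radius one.* Put at least half of the mass of `μ^{*2k}` on a
finite set `K`. Once the ball of radius `r (2n)` contains `K`, the Chapman–Kolmogorov equation gives
`μ^{*(2n+2k)}(e) ≥ μ^{*2n}(e) / (2C)`. The constant does not depend on `k`, which rules out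
exponential decay (`tendsto_returnQuotient_of_weaklyAlmostConstant`).

*Spectral radius one gives almost constancy.* The number `μ^{*2n}(e) - μ^{*(2n+2k)}(e)` is the
average of the nonnegative numbers `μ^{*2n}(e) - μ^{*2n}(h)` with weights `μ^{*2k}(h)`. Non-degeneracy
and aperiodicity put every `g` in the support of some `μ^{*2k}`, so the ratios at even times tend to
one. Odd times follow by dominated convergence (`tendsto_ratio`), and a radius that grows slowly
enough makes the convergence uniform on balls (`exists_almostConstant`).

*Spectral radius one gives amenability.* The probability densities `μ^{*n}(g)² / μ^{*2n}(e)` are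
asymptotically invariant in `ℓ¹(G)`, because the `ℓ²`-normalised `μ^{*n}` are in `ℓ²(G)`. Their limit
along an ultrafilter is an invariant mean (`isAmenableGroup_of_tendsto_returnQuotient`).

*Amenability gives spectral radius one.* If `μ^{*2n}(e) ≤ c ^ n` with `c < 1`, then log-convexity of
`n ↦ ‖μ^{*n} * 1_F‖²` gives `‖μ^{*n} * 1_F‖² ≤ c ^ n |F|` for every finite set `F`, whereas `μ^{*n}`
is mostly carried by a finite set `K`. By Cauchy–Schwarz `|K F| ≥ 2 |F|` for `n` large
(`exists_two_mul_card_le`). Hall's marriage theorem then provides a two-to-one paradoxical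
decomposition of `G`, which no invariant mean allows
(`not_isAmenableGroup_of_two_mul_card_le`).
-/

namespace RandomWalk

variable {G : Type*} [Group G] [MeasurableSpace G]

/-! ### Convolution powers as functions on the group -/

/-- The probability `μ^{*n}(g)` that the walk driven by `μ` is at `g` after `n` steps, as a real
number. -/
noncomputable def stepProb (μ : Measure G) (n : ℕ) (g : G) : ℝ := (convPow μ n).real {g}

theorem stepProb_nonneg (μ : Measure G) (n : ℕ) (g : G) : 0 ≤ stepProb μ n g :=
  measureReal_nonneg

variable [DiscreteMeasurableSpace G]

theorem stepProb_zero_one (μ : Measure G) : stepProb μ 0 1 = 1 := by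
  simp [stepProb, convPow, measureReal_def]

theorem stepProb_zero_of_ne (μ : Measure G) {g : G} (hg : g ≠ 1) : stepProb μ 0 g = 0 := by
  simp [stepProb, convPow, measureReal_def, hg.symm]

variable [Countable G]

theorem mconv_singleton (α β : Measure G) [SFinite β] (g : G) :
    (α.mconv β) {g} = ∑' h, α {h} * β {h⁻¹ * g} := by
  classical
  rw [← lintegral_indicator_one (measurableSet_singleton g),
    Measure.lintegral_mconv Measurable.of_discrete, lintegral_countable']
  refine tsum_congr fun h => ?_
  have : (fun y => Set.indicator {g} (1 : G → ENNReal) (h * y)) =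
      Set.indicator {h⁻¹ * g} 1 := by
    ext y
    simp [Set.indicator_apply, eq_inv_mul_iff_mul_eq]
  rw [this, lintegral_indicator_one (measurableSet_singleton _), mul_comm]

theorem convPow_one (μ : Measure G) [SFinite μ] : convPow μ 1 = μ := by
  simp [convPow, Measure.dirac_one_mconv]

variable (μ : Measure G) [IsProbabilityMeasure μ]

theorem isProbabilityMeasure_convPow (n : ℕ) : IsProbabilityMeasure (convPow μ n) := by
  induction n with
  | zero => unfold convPow; infer_instance
  | succ n ih => 
    unfold convPow Measure.mconv
    exact Measure.isProbabilityMeasure_map (by fun_prop)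

theorem convPow_add (m n : ℕ) : convPow μ (m + n) = (convPow μ m).mconv (convPow μ n) := by
  have := isProbabilityMeasure_convPow μ
  induction n with
  | zero => simp [convPow, Measure.mconv_dirac_one]
  | succ n ih =>
    rw [← add_assoc, convPow, convPow, ih, Measure.mconv_assoc]

theorem hasSum_stepProb (n : ℕ) : HasSum (stepProb μ n) 1 := by
  have := isProbabilityMeasure_convPow μ n
  have h := lintegral_countable' (μ := convPow μ n) (fun _ => 1)
  simp only [lintegral_one, measure_univ, one_mul] at h
  have h2 : HasSum (fun g => convPow μ n {g}) 1 := by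
    rw [h]; exact ENNReal.summable.hasSum
  have h3 := (ENNReal.hasSum_toReal (f := fun g => convPow μ n {g}) (by rw [← h]; simp))
  rw [← ENNReal.tsum_toReal_eq (by intro; finiteness), ← h] at h3
  exact h3

/-- The Chapman–Kolmogorov equation. -/
theorem hasSum_stepProb_mul (m n : ℕ) (g : G) :
    HasSum (fun h => stepProb μ m h * stepProb μ n (h⁻¹ * g)) (stepProb μ (m + n) g) := by
  have := isProbabilityMeasure_convPow μ
  have h1 := mconv_singleton (convPow μ m) (convPow μ n) g
  rw [← convPow_add] at h1
  have hne : ∑' h, convPow μ m {h} * convPow μ n {h⁻¹ * g} ≠ ⊤ := by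
    rw [← h1]; finiteness
  have h3 := ENNReal.hasSum_toReal hne
  rw [← ENNReal.tsum_toReal_eq (by intro; finiteness), ← h1] at h3
  simpa [stepProb, measureReal_def] using h3

variable {μ}

theorem stepProb_inv (hsymm : IsSymmetric μ) (n : ℕ) (g : G) :
    stepProb μ n g⁻¹ = stepProb μ n g := by
  induction n generalizing g with
  | zero =>
    by_cases hg : g = 1
    · simp [hg]
    · rw [stepProb_zero_of_ne _ hg, stepProb_zero_of_ne _ (by simpa using hg)]
  | succ n ih =>
    have h1 := hasSum_stepProb_mul μ n 1 g⁻¹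
    have h2 := hasSum_stepProb_mul μ 1 n g
    rw [add_comm 1 n] at h2
    -- the bijection `h ↦ g * h` turns one sum into the other
    rw [← (Equiv.mulLeft g).hasSum_iff] at h2
    refine h1.unique (h2.congr_fun ?_)
    intro h
    have hs : ∀ x : G, stepProb μ 1 x⁻¹ = stepProb μ 1 x := by
      intro x
      simp only [stepProb, convPow_one, measureReal_def, hsymm x]
    have e1 := hs (g * h)
    have e2 := ih h
    simp only [Function.comp, Equiv.coe_mulLeft, mul_inv_rev, inv_mul_cancel_right] at e1 ⊢
    rw [e1, e2, mul_comm]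

/-- Translates of `μ^{*m}` and `μ^{*n}` have `ℓ²` inner product given by `μ^{*(m+n)}`. -/
theorem hasSum_translate_mul_translate (hsymm : IsSymmetric μ) (m n : ℕ) (a b : G) :
    HasSum (fun g => stepProb μ m (g * a⁻¹) * stepProb μ n (g * b⁻¹))
      (stepProb μ (m + n) (a * b⁻¹)) := by
  have h := hasSum_stepProb_mul μ m n (a * b⁻¹)
  rw [← ((Equiv.inv G).trans (Equiv.mulLeft a)).hasSum_iff] at h
  refine h.congr_fun fun g => ?_
  have := stepProb_inv hsymm m (g * a⁻¹)
  simp only [mul_inv_rev, inv_inv] at this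
  simp [Function.comp, mul_assoc, this]

theorem hasSum_sq_stepProb (hsymm : IsSymmetric μ) (n : ℕ) :
    HasSum (fun g => stepProb μ n g ^ 2) (stepProb μ (2 * n) 1) := by
  simpa [← two_mul, sq] using hasSum_translate_mul_translate hsymm n n (1 : G) 1

/-- The squared `ℓ²` distance between `μ^{*n}` and its translate by `g`. -/
theorem hasSum_sq_sub_stepProb (hsymm : IsSymmetric μ) (n : ℕ) (g : G) :
    HasSum (fun h => (stepProb μ n (g * h) - stepProb μ n h) ^ 2)
      (2 * (stepProb μ (2 * n) 1 - stepProb μ (2 * n) g)) := by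
  have h1 := hasSum_sq_stepProb hsymm n
  have h2 := h1
  rw [← (Equiv.mulLeft g).hasSum_iff] at h2
  have h3 := hasSum_stepProb_mul μ n n g⁻¹
  rw [stepProb_inv hsymm, ← two_mul] at h3
  rw [mul_sub, two_mul (stepProb μ (2 * n) 1)]
  refine ((h2.add h1).sub (h3.mul_left 2)).congr_fun fun h => ?_
  have e := stepProb_inv hsymm n (g * h)
  rw [mul_inv_rev] at e
  simp only [Function.comp, Equiv.coe_mulLeft, e]
  ring

end RandomWalk

namespace RandomWalk

/-! ### Word length -/

section WordLength

variable {G : Type*} [Group G]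

theorem exists_word_of_closure_eq_top {S : Set G} (hgen : Subgroup.closure S = ⊤) (g : G) :
    ∃ w : List G, (∀ s ∈ w, s ∈ S ∨ s⁻¹ ∈ S) ∧ w.prod = g ∧ w.length = wordLength S g := by
  have hne : {n : ℕ | ∃ w : List G, (∀ s ∈ w, s ∈ S ∨ s⁻¹ ∈ S) ∧ w.prod = g ∧
      w.length = n}.Nonempty := by
    have hg : g ∈ (Subgroup.closure S).toSubmonoid := by simp [hgen]
    rw [Subgroup.closure_toSubmonoid] at hg
    obtain ⟨w, hw, hprod⟩ := Submonoid.exists_list_of_mem_closure hg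
    exact ⟨w.length, w, by simpa using hw, hprod, rfl⟩
  exact Nat.sInf_mem hne

theorem finite_setOf_wordLength_le {S : Set G} (hS : S.Finite) (hgen : Subgroup.closure S = ⊤)
    (k : ℕ) : {g : G | wordLength S g ≤ k}.Finite := by
  have hT : (S ∪ S⁻¹).Finite := hS.union hS.inv
  have : Finite ↥(S ∪ S⁻¹) := hT
  refine ((List.finite_length_le ↥(S ∪ S⁻¹) k).image
    fun l => (l.map Subtype.val).prod).subset fun g hg => ?_
  obtain ⟨w, hw, hprod, hlen⟩ := exists_word_of_closure_eq_top hgen g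
  lift w to List ↥(S ∪ S⁻¹) using fun s hs => by simpa using hw s hs
  exact ⟨w, by simpa using hlen.trans_le hg, hprod⟩

theorem countable_of_closure_eq_top {S : Set G} (hS : S.Finite) (hgen : Subgroup.closure S = ⊤) :
    Countable G := by
  rw [← Set.countable_univ_iff]
  refine (Set.countable_iUnion fun k => (finite_setOf_wordLength_le hS hgen k).countable).mono ?_
  exact fun g _ => Set.mem_iUnion.2 ⟨wordLength S g, le_refl (wordLength S g)⟩

end WordLength

/-! ### Log-convex sequences -/

theorem ratio_monotone_of_logConvex {s : ℕ → ℝ} (hpos : ∀ n, 0 < s n)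
    (hlog : ∀ n, s (n + 1) ^ 2 ≤ s n * s (n + 2)) : Monotone fun n => s (n + 1) / s n := by
  refine monotone_nat_of_le_succ fun n => ?_
  rw [div_le_div_iff₀ (hpos _) (hpos _)]
  nlinarith [hlog n]

theorem pow_mul_le_of_mul_le_succ {s : ℕ → ℝ} {t : ℝ} (ht : 0 ≤ t) (h : ∀ n, t * s n ≤ s (n + 1))
    (n : ℕ) : t ^ n * s 0 ≤ s n := by
  induction n with
  | zero => simp
  | succ n ih =>
    calc t ^ (n + 1) * s 0 = t * (t ^ n * s 0) := by ring
      _ ≤ t * s n := by gcongr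
      _ ≤ s (n + 1) := h n

theorem le_pow_mul_of_succ_le_mul {s : ℕ → ℝ} {t : ℝ} (ht : 0 ≤ t) (h : ∀ n, s (n + 1) ≤ t * s n)
    (n : ℕ) : s n ≤ t ^ n * s 0 := by
  induction n with
  | zero => simp
  | succ n ih =>
    calc s (n + 1) ≤ t * s n := h n
      _ ≤ t * (t ^ n * s 0) := by gcongr
      _ = t ^ (n + 1) * s 0 := by ring

/-- A log-convex sequence that decays exponentially at rate `c` does so from the first step on,
with constant one: its successive ratios increase, so one of them exceeding `c` would force a slower
decay. -/
theorem succ_le_mul_of_logConvex {s : ℕ → ℝ} (hpos : ∀ n, 0 < s n)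
    (hlog : ∀ n, s (n + 1) ^ 2 ≤ s n * s (n + 2)) {A c : ℝ} (hc : 0 < c)
    (hA : ∀ n, s n ≤ A * c ^ n) (n : ℕ) : s (n + 1) ≤ c * s n := by
  by_contra! hn
  set t := s (n + 1) / s n with ht
  have hct : c < t := by rwa [ht, lt_div_iff₀ (hpos n)]
  have hgrow : ∀ j, t ^ j * s n ≤ s (n + j) := by
    refine pow_mul_le_of_mul_le_succ (s := fun j => s (n + j)) (hc.trans hct).le fun j => ?_
    have := ratio_monotone_of_logConvex hpos hlog (Nat.le_add_right n j)
    rwa [← le_div_iff₀ (hpos _)]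
  obtain ⟨j, hj⟩ := pow_unbounded_of_one_lt (A * c ^ n / s n) ((one_lt_div hc).2 hct)
  have h1 := (hgrow j).trans (hA (n + j))
  rw [div_pow, div_lt_div_iff₀ (hpos n) (by positivity)] at hj
  rw [pow_add] at h1
  nlinarith

variable {G : Type*} [Group G] [MeasurableSpace G] [DiscreteMeasurableSpace G] [Countable G]
  {μ : Measure G} [IsProbabilityMeasure μ]

/-! ### Energy of a finite set -/

/-- The inner product `⟨μ^{*n} * 1_F, 1_F⟩` in `ℓ²(G)`. -/
noncomputable def energy (μ : Measure G) (F : Finset G) (n : ℕ) : ℝ :=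
  ∑ a ∈ F, ∑ b ∈ F, stepProb μ n (a * b⁻¹)

/-- The convolution `μ^{*n} * 1_F`. -/
noncomputable def spread (μ : Measure G) (F : Finset G) (n : ℕ) (g : G) : ℝ :=
  ∑ a ∈ F, stepProb μ n (g * a⁻¹)

theorem hasSum_spread_mul_spread (hsymm : IsSymmetric μ) (F : Finset G) (m n : ℕ) :
    HasSum (fun g => spread μ F m g * spread μ F n g) (energy μ F (m + n)) := by
  simp only [spread, energy, Finset.sum_mul_sum]
  exact hasSum_sum fun a _ => hasSum_sum fun b _ => hasSum_translate_mul_translate hsymm m n a b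

/-- Cauchy–Schwarz for `μ^{*m} * 1_F` and `μ^{*n} * 1_F`. -/
theorem energy_add_sq_le (hsymm : IsSymmetric μ) (F : Finset G) (m n : ℕ) :
    energy μ F (m + n) ^ 2 ≤ energy μ F (2 * m) * energy μ F (2 * n) := by
  have key : ∀ t : ℝ, 0 ≤ energy μ F (2 * m) * (t * t) + (2 * energy μ F (m + n)) * t +
      energy μ F (2 * n) := by
    intro t
    have hmm := (hasSum_spread_mul_spread hsymm F m m).mul_right (t * t)
    have hmn := ((hasSum_spread_mul_spread hsymm F m n).mul_left 2).mul_right t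
    have hnn := hasSum_spread_mul_spread hsymm F n n
    rw [← two_mul] at hmm hnn
    refine ((hmm.add hmn).add hnn).nonneg fun g => ?_
    nlinarith [sq_nonneg (t * spread μ F m g + spread μ F n g)]
  have := discrim_le_zero key
  rw [discrim] at this
  nlinarith

theorem energy_logConvex (hsymm : IsSymmetric μ) (F : Finset G) (n : ℕ) :
    energy μ F (2 * (n + 1)) ^ 2 ≤ energy μ F (2 * n) * energy μ F (2 * (n + 2)) := by
  have := energy_add_sq_le hsymm F n (n + 2)
  rwa [show n + (n + 2) = 2 * (n + 1) by ring] at this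

omit [DiscreteMeasurableSpace G] [Countable G] [IsProbabilityMeasure μ] in
theorem energy_singleton_one (n : ℕ) : energy μ {1} n = stepProb μ n 1 := by
  simp [energy]

/-! ### Return probabilities -/

/-- At even times the walk is most likely to be at the identity. -/
theorem stepProb_two_mul_le (hsymm : IsSymmetric μ) (n : ℕ) (g : G) :
    stepProb μ (2 * n) g ≤ stepProb μ (2 * n) 1 := by
  have := (hasSum_sq_sub_stepProb hsymm n g).nonneg fun h => sq_nonneg _
  linarith

theorem stepProb_two_mul_one_pos (hsymm : IsSymmetric μ) (n : ℕ) : 0 < stepProb μ (2 * n) 1 := by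
  refine (stepProb_nonneg _ _ _).lt_of_ne' fun h0 => ?_
  have h := hasSum_sq_stepProb hsymm n
  rw [h0, hasSum_zero_iff_of_nonneg fun g => sq_nonneg _] at h
  have h1 : stepProb μ n = fun _ => 0 := funext fun g => by simpa using congrFun h g
  have h2 := hasSum_stepProb μ n
  rw [h1] at h2
  exact zero_ne_one (hasSum_zero.unique h2)

/-- The quotient `μ^{*(2n+2)}(e) / μ^{*2n}(e)` of successive even return probabilities. -/
noncomputable def returnQuotient (μ : Measure G) (n : ℕ) : ℝ :=
  stepProb μ (2 * (n + 1)) 1 / stepProb μ (2 * n) 1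

theorem returnQuotient_monotone (hsymm : IsSymmetric μ) : Monotone (returnQuotient μ) :=
  ratio_monotone_of_logConvex (s := fun n => stepProb μ (2 * n) 1)
    (stepProb_two_mul_one_pos hsymm) fun n => by
      simpa only [energy_singleton_one] using energy_logConvex hsymm {1} n

/-- `μ^{*(k+n)}(e)` is the average of `μ^{*n}` with weights `μ^{*k}`; here the deficit from
`μ^{*n}(e)` is written as an average of deficits, all nonnegative when `n` is even. -/
theorem hasSum_mul_sub (hsymm : IsSymmetric μ) (k n : ℕ) :
    HasSum (fun h => stepProb μ k h * (stepProb μ n 1 - stepProb μ n h))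
      (stepProb μ n 1 - stepProb μ (k + n) 1) := by
  have h1 := (hasSum_stepProb μ k).mul_right (stepProb μ n 1)
  have h2 := hasSum_stepProb_mul μ k n 1
  rw [one_mul] at h1
  refine (h1.sub h2).congr_fun fun h => ?_
  rw [mul_one, stepProb_inv hsymm, mul_sub]

/-- A single term of `hasSum_mul_sub`: a small drop of the return probability over `k` steps forces
`μ^{*2n}(g)` to be close to `μ^{*2n}(e)` wherever `μ^{*k}(g)` is positive. -/
theorem stepProb_mul_sub_le (hsymm : IsSymmetric μ) (k n : ℕ) (g : G) :
    stepProb μ k g * (stepProb μ (2 * n) 1 - stepProb μ (2 * n) g) ≤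
      stepProb μ (2 * n) 1 - stepProb μ (k + 2 * n) 1 :=
  le_hasSum (hasSum_mul_sub hsymm k (2 * n)) g fun h _ =>
    mul_nonneg (stepProb_nonneg _ _ _) (sub_nonneg.2 (stepProb_two_mul_le hsymm n h))

theorem returnQuotient_pos (hsymm : IsSymmetric μ) (n : ℕ) : 0 < returnQuotient μ n :=
  div_pos (stepProb_two_mul_one_pos hsymm _) (stepProb_two_mul_one_pos hsymm _)

theorem returnQuotient_le_one (hsymm : IsSymmetric μ) (n : ℕ) : returnQuotient μ n ≤ 1 := by
  rw [returnQuotient, div_le_one (stepProb_two_mul_one_pos hsymm _)]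
  have := (hasSum_mul_sub hsymm 2 (2 * n)).nonneg fun h =>
    mul_nonneg (stepProb_nonneg _ _ _) (sub_nonneg.2 (stepProb_two_mul_le hsymm n h))
  rw [show 2 * (n + 1) = 2 + 2 * n by ring]
  linarith

/-- Either the spectral radius of the walk is one, in the sense that the quotients of successive
even return probabilities tend to one, or the return probabilities decay exponentially. -/
theorem tendsto_returnQuotient_or_exists_le_pow (hsymm : IsSymmetric μ) :
    Tendsto (returnQuotient μ) atTop (nhds 1) ∨
      ∃ c : ℝ, 0 < c ∧ c < 1 ∧ ∀ n, stepProb μ (2 * n) 1 ≤ c ^ n := by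
  have hbdd : BddAbove (Set.range (returnQuotient μ)) :=
    ⟨1, by rintro _ ⟨n, rfl⟩; exact returnQuotient_le_one hsymm n⟩
  have hlim := tendsto_atTop_ciSup (returnQuotient_monotone hsymm) hbdd
  set L := ⨆ n, returnQuotient μ n
  have hle : ∀ n, returnQuotient μ n ≤ L := le_ciSup hbdd
  have hL : 0 < L := (returnQuotient_pos hsymm 0).trans_le (hle 0)
  rcases (ciSup_le (returnQuotient_le_one hsymm) : L ≤ 1).eq_or_lt with h | h
  · exact Or.inl (h ▸ hlim)
  · refine Or.inr ⟨L, hL, h, fun n => ?_⟩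
    have := le_pow_mul_of_succ_le_mul (s := fun n => stepProb μ (2 * n) 1) hL.le
      (fun n => (div_le_iff₀ (stepProb_two_mul_one_pos hsymm n)).1 (hle n)) n
    simpa [stepProb_zero_one] using this

/-! ### Positivity at even times -/

theorem stepProb_mul_le (m n : ℕ) (g h : G) :
    stepProb μ m g * stepProb μ n h ≤ stepProb μ (m + n) (g * h) := by
  have := le_hasSum (hasSum_stepProb_mul μ m n (g * h)) g fun _ _ =>
    mul_nonneg (stepProb_nonneg _ _ _) (stepProb_nonneg _ _ _)
  simpa using this

theorem exists_stepProb_pos (hnd : IsNondegenerate μ) (g : G) : ∃ n, 0 < stepProb μ n g := by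
  have hg : g ∈ Subsemigroup.closure {g : G | 0 < μ {g}} := by
    rw [show Subsemigroup.closure {g : G | 0 < μ {g}} = ⊤ from hnd]
    trivial
  induction hg using Subsemigroup.closure_induction with
  | mem x hx =>
    refine ⟨1, ?_⟩
    rw [stepProb, convPow_one]
    exact ENNReal.toReal_pos (ne_of_gt hx) (by finiteness)
  | mul x y _ _ hx hy =>
    obtain ⟨m, hm⟩ := hx
    obtain ⟨n, hn⟩ := hy
    exact ⟨m + n, (mul_pos hm hn).trans_le (stepProb_mul_le m n x y)⟩

theorem exists_odd_stepProb_one_pos (hap : IsAperiodic μ) : ∃ n, Odd n ∧ 0 < stepProb μ n 1 := by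
  by_contra! hcon
  have h2 : 2 ∣ period μ := by
    refine Nat.dvd_setGcd_iff.2 fun n hn => ?_
    by_contra hodd
    have := isProbabilityMeasure_convPow μ n
    have hpos : 0 < stepProb μ n 1 := ENNReal.toReal_pos (ne_of_gt hn) (by finiteness)
    exact hpos.not_ge (hcon n (by rwa [← Nat.not_even_iff_odd, even_iff_two_dvd]))
  rw [show period μ = 1 from hap] at h2
  omega

theorem exists_stepProb_two_mul_pos (hnd : IsNondegenerate μ) (hap : IsAperiodic μ) (g : G) :
    ∃ k, 0 < stepProb μ (2 * k) g := by
  obtain ⟨m, hm⟩ := exists_stepProb_pos hnd g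
  obtain ⟨n, hodd, hn⟩ := exists_odd_stepProb_one_pos hap
  rcases Nat.even_or_odd m with he | ho
  · obtain ⟨k, rfl⟩ := even_iff_two_dvd.1 he
    exact ⟨k, hm⟩
  · obtain ⟨k, hk⟩ := even_iff_two_dvd.1 (ho.add_odd hodd)
    refine ⟨k, ?_⟩
    rw [← hk]
    simpa using (mul_pos hm hn).trans_le (stepProb_mul_le m n g 1)

/-! ### Ratio limits at spectral radius one -/

theorem tendsto_stepProb_add_div (hsymm : IsSymmetric μ)
    (hlim : Tendsto (returnQuotient μ) atTop (nhds 1)) (k : ℕ) :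
    Tendsto (fun n => stepProb μ (2 * (n + k)) 1 / stepProb μ (2 * n) 1) atTop (nhds 1) := by
  induction k with
  | zero =>
    refine tendsto_const_nhds.congr fun n => ?_
    exact (div_self (stepProb_two_mul_one_pos hsymm n).ne').symm
  | succ k ih =>
    have h := (hlim.comp (tendsto_add_atTop_nat k)).mul ih
    rw [one_mul] at h
    refine h.congr fun n => ?_
    have h1 := (stepProb_two_mul_one_pos hsymm (n + k)).ne'
    simp only [Function.comp, returnQuotient, ← add_assoc]
    field_simp

/-- Spectral radius one makes the even-time distributions asymptotically constant: the return
probability hardly drops over `2k` steps, where `k` is chosen with `μ^{*2k}(g) > 0`. -/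
theorem tendsto_stepProb_two_mul_div (hsymm : IsSymmetric μ) (hnd : IsNondegenerate μ)
    (hap : IsAperiodic μ) (hlim : Tendsto (returnQuotient μ) atTop (nhds 1)) (g : G) :
    Tendsto (fun n => stepProb μ (2 * n) g / stepProb μ (2 * n) 1) atTop (nhds 1) := by
  obtain ⟨k, hk⟩ := exists_stepProb_two_mul_pos hnd hap g
  have hlow := ((tendsto_stepProb_add_div hsymm hlim k).const_sub 1).div_const
    (stepProb μ (2 * k) g) |>.const_sub 1
  rw [sub_self, zero_div, sub_zero] at hlow
  refine tendsto_of_tendsto_of_tendsto_of_le_of_le hlow tendsto_const_nhds (fun n => ?_)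
    fun n => ?_
  · have h0 := stepProb_two_mul_one_pos hsymm n
    have h := stepProb_mul_sub_le hsymm (2 * k) n g
    rw [show 2 * k + 2 * n = 2 * (n + k) by ring] at h
    simp only
    rw [sub_le_comm, le_div_iff₀ hk, one_sub_div h0.ne', one_sub_div h0.ne', div_mul_eq_mul_div]
    gcongr
    linarith
  · exact div_le_one_of_le₀ (stepProb_two_mul_le hsymm n g) (stepProb_nonneg _ _ _)

/-- One more step averages the ratios at even times, so it does not change their limit. -/
theorem tendsto_stepProb_two_mul_add_one_div (hsymm : IsSymmetric μ) (hnd : IsNondegenerate μ)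
    (hap : IsAperiodic μ) (hlim : Tendsto (returnQuotient μ) atTop (nhds 1)) (g : G) :
    Tendsto (fun n => stepProb μ (2 * n + 1) g / stepProb μ (2 * n) 1) atTop (nhds 1) := by
  have hsum : ∀ n, ∑' h, stepProb μ 1 h * (stepProb μ (2 * n) (h⁻¹ * g) / stepProb μ (2 * n) 1) =
      stepProb μ (2 * n + 1) g / stepProb μ (2 * n) 1 := by
    intro n
    rw [add_comm, ← ((hasSum_stepProb_mul μ 1 (2 * n) g).div_const _).tsum_eq]
    simp only [mul_div_assoc]
  rw [← (hasSum_stepProb μ 1).tsum_eq]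
  simp only [← hsum]
  refine tendsto_tsum_of_dominated_convergence (hasSum_stepProb μ 1).summable (fun h => ?_)
    (Eventually.of_forall fun n h => ?_)
  · simpa using (tendsto_stepProb_two_mul_div hsymm hnd hap hlim (h⁻¹ * g)).const_mul
      (stepProb μ 1 h)
  · have h0 := stepProb_nonneg μ
    rw [Real.norm_of_nonneg (mul_nonneg (h0 _ _) (div_nonneg (h0 _ _) (h0 _ _)))]
    exact mul_le_of_le_one_right (h0 _ _)
      (div_le_one_of_le₀ (stepProb_two_mul_le hsymm n _) (h0 _ _))

theorem tendsto_ratio (hsymm : IsSymmetric μ) (hnd : IsNondegenerate μ)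
    (hap : IsAperiodic μ) (hlim : Tendsto (returnQuotient μ) atTop (nhds 1)) (g : G) :
    Tendsto (fun n => ratio μ n g) atTop (nhds 1) := by
  have heven := tendsto_stepProb_two_mul_div hsymm hnd hap hlim g
  have hodd := (tendsto_stepProb_two_mul_add_one_div hsymm hnd hap hlim g).div
    (tendsto_stepProb_two_mul_add_one_div hsymm hnd hap hlim 1) one_ne_zero
  rw [div_one] at hodd
  have hodd' : Tendsto (fun n => stepProb μ (2 * n + 1) g / stepProb μ (2 * n + 1) 1) atTop
      (nhds 1) :=
    hodd.congr fun n => div_div_div_cancel_right₀ (stepProb_two_mul_one_pos hsymm n).ne' _ _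
  rw [tendsto_def] at heven hodd' ⊢
  intro s hs
  obtain ⟨N₁, h₁⟩ := mem_atTop_sets.1 (heven s hs)
  obtain ⟨N₂, h₂⟩ := mem_atTop_sets.1 (hodd' s hs)
  refine mem_atTop_sets.2 ⟨2 * (N₁ + N₂) + 1, fun n hn => ?_⟩
  obtain ⟨k, rfl | rfl⟩ := Nat.even_or_odd' n
  · exact h₁ k (by omega)
  · exact h₂ k (by omega)

omit [DiscreteMeasurableSpace G] [Countable G] [IsProbabilityMeasure μ] in
/-- If the ratios tend to one pointwise, then they do so uniformly over balls whose radius grows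
slowly enough. -/
theorem exists_almostConstant {S : Set G} (hfin : ∀ k, {g : G | wordLength S g ≤ k}.Finite)
    (hlim : ∀ g : G, Tendsto (fun n => ratio μ n g) atTop (nhds 1)) :
    ∃ r : ℕ → ℝ, Tendsto r atTop atTop ∧ AlmostConstant S μ r := by
  classical
  let P : ℕ → ℕ → Prop := fun n k => ∀ g : G, wordLength S g ≤ k →
    |ratio μ n g - 1| ≤ 1 / (k + 1 : ℝ)
  have hP : ∀ k, ∀ᶠ n in atTop, P n k := by
    intro k
    refine ((hfin k).eventually_all (p := fun g n => |ratio μ n g - 1| ≤ 1 / (k + 1 : ℝ))).2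
      fun g _ => ?_
    have := Metric.tendsto_nhds.1 (hlim g) (1 / (k + 1 : ℝ)) (by positivity)
    filter_upwards [this] with n hn
    exact hn.le
  -- the largest radius up to `n` at which the estimate already holds at time `n`
  let R : ℕ → ℕ := fun n => Nat.findGreatest (P n) n
  have hR : ∀ k, ∀ᶠ n in atTop, k ≤ R n := fun k => by
    filter_upwards [hP k, eventually_ge_atTop k] with n hn hkn
    exact Nat.le_findGreatest hkn hn
  refine ⟨fun n => R n, tendsto_natCast_atTop_atTop.comp (tendsto_atTop.2 hR), fun ε hε => ?_⟩
  obtain ⟨k, hk⟩ := exists_nat_one_div_lt hε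
  filter_upwards [hR (k + 1)] with n hn g hg
  have hPn : P n (R n) := Nat.findGreatest_of_ne_zero (m := R n) rfl (by omega)
  refine (hPn g (by exact_mod_cast hg)).trans (le_trans ?_ hk.le)
  have : (k : ℝ) ≤ R n := by exact_mod_cast (by omega : k ≤ R n)
  gcongr

/-- If the ratios are bounded below on balls of growing radius, then the return probabilities do not
decay exponentially: at time `2k` the walk is in a fixed finite set with probability at least one
half, which bounds `μ^{*(2n+2k)}(e) / μ^{*2n}(e)` from below independently of `k`. -/
theorem tendsto_returnQuotient_of_weaklyAlmostConstant {S : Set G} {r : ℕ → ℝ}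
    (hsymm : IsSymmetric μ) (hr : Tendsto r atTop atTop) (h : WeaklyAlmostConstant S μ r) :
    Tendsto (returnQuotient μ) atTop (nhds 1) := by
  obtain ⟨C, hC, hev⟩ := h
  refine (tendsto_returnQuotient_or_exists_le_pow hsymm).resolve_right ?_
  rintro ⟨c, hc0, hc1, hc⟩
  have hdecay : ∀ n, stepProb μ (2 * (n + 1)) 1 ≤ c * stepProb μ (2 * n) 1 :=
    succ_le_mul_of_logConvex (s := fun n => stepProb μ (2 * n) 1) (A := 1)
      (stepProb_two_mul_one_pos hsymm)
      (fun n => by simpa only [energy_singleton_one] using energy_logConvex hsymm {1} n) hc0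
      (by simpa using hc)
  obtain ⟨k, hk⟩ := exists_pow_lt_of_lt_one (show 0 < 1 / (2 * C) by positivity) hc1
  obtain ⟨K, hK⟩ := ((hasSum_stepProb μ (2 * k)).eventually (lt_mem_nhds one_half_lt_one)).exists
  have hrK : ∀ᶠ n in atTop, ∀ g ∈ K, (wordLength S g : ℝ) ≤ r n :=
    (Finset.eventually_all K).2 fun g _ => hr.eventually_ge_atTop _
  obtain ⟨N, hN⟩ := eventually_atTop.1 (hev.and hrK)
  obtain ⟨hlow, hball⟩ := hN (2 * N) (by omega)
  have hpos := stepProb_two_mul_one_pos hsymm N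
  have h1 : stepProb μ (2 * (N + k)) 1 ≤ c ^ k * stepProb μ (2 * N) 1 :=
    le_pow_mul_of_succ_le_mul (s := fun k => stepProb μ (2 * (N + k)) 1) hc0.le
      (fun j => hdecay (N + j)) k
  have h2 : ∑ g ∈ K, stepProb μ (2 * k) g * (stepProb μ (2 * N) 1 / C) ≤
      stepProb μ (2 * (N + k)) 1 := by
    have hs := hasSum_stepProb_mul μ (2 * k) (2 * N) 1
    rw [show 2 * k + 2 * N = 2 * (N + k) by ring] at hs
    refine le_trans (Finset.sum_le_sum fun g hg => ?_) (sum_le_hasSum K (fun g _ =>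
      mul_nonneg (stepProb_nonneg _ _ _) (stepProb_nonneg _ _ _)) hs)
    refine mul_le_mul_of_nonneg_left ?_ (stepProb_nonneg _ _ _)
    have := (hlow g (hball g hg)).1
    change 1 / C ≤ stepProb μ (2 * N) g / stepProb μ (2 * N) 1 at this
    rw [div_le_div_iff₀ hC hpos] at this
    rw [mul_one, stepProb_inv hsymm, div_le_iff₀ hC]
    linarith
  rw [← Finset.sum_mul] at h2
  have h3 : 1 / 2 * (stepProb μ (2 * N) 1 / C) ≤ c ^ k * stepProb μ (2 * N) 1 :=
    le_trans (by gcongr) (h2.trans h1)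
  have h4 : c ^ k * stepProb μ (2 * N) 1 < 1 / (2 * C) * stepProb μ (2 * N) 1 := by gcongr
  have h5 : 1 / 2 * (stepProb μ (2 * N) 1 / C) = 1 / (2 * C) * stepProb μ (2 * N) 1 := by
    field_simp
  linarith

/-! ### An invariant mean from spectral radius one -/

/-- The mass of `A` under the probability measure on `G` with density
`g ↦ μ^{*n}(g)² / μ^{*2n}(e)`. -/
noncomputable def sqMass (μ : Measure G) (n : ℕ) (A : Set G) : ℝ :=
  ∑' g, A.indicator (fun h => stepProb μ n h ^ 2 / stepProb μ (2 * n) 1) g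

theorem hasSum_sqMass_density (hsymm : IsSymmetric μ) (n : ℕ) :
    HasSum (fun h => stepProb μ n h ^ 2 / stepProb μ (2 * n) 1) 1 := by
  simpa [div_self (stepProb_two_mul_one_pos hsymm n).ne'] using
    (hasSum_sq_stepProb hsymm n).div_const (stepProb μ (2 * n) 1)

theorem hasSum_sqMass (hsymm : IsSymmetric μ) (n : ℕ) (A : Set G) :
    HasSum (A.indicator fun h => stepProb μ n h ^ 2 / stepProb μ (2 * n) 1) (sqMass μ n A) :=
  ((hasSum_sqMass_density hsymm n).summable.indicator A).hasSum

theorem sqMass_univ (hsymm : IsSymmetric μ) (n : ℕ) : sqMass μ n Set.univ = 1 := by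
  simpa [sqMass] using (hasSum_sqMass_density hsymm n).tsum_eq

theorem sqMass_union (hsymm : IsSymmetric μ) (n : ℕ) {A B : Set G} (hAB : Disjoint A B) :
    sqMass μ n (A ∪ B) = sqMass μ n A + sqMass μ n B := by
  have h := (hasSum_sqMass hsymm n A).add (hasSum_sqMass hsymm n B)
  refine (hasSum_sqMass hsymm n (A ∪ B)).unique (h.congr_fun fun g => ?_)
  rw [Set.indicator_union_of_disjoint hAB]

theorem sqMass_mem_Icc (hsymm : IsSymmetric μ) (n : ℕ) (A : Set G) :
    sqMass μ n A ∈ Set.Icc (0 : ℝ) 1 := by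
  have hnn : ∀ h, 0 ≤ stepProb μ n h ^ 2 / stepProb μ (2 * n) 1 := fun h =>
    div_nonneg (sq_nonneg _) (stepProb_nonneg _ _ _)
  refine ⟨(hasSum_sqMass hsymm n A).nonneg fun g => Set.indicator_nonneg (fun h _ => hnn h) g, ?_⟩
  exact hasSum_le (fun g => Set.indicator_le_self' (fun h _ => hnn h) g)
    (hasSum_sqMass hsymm n A) (hasSum_sqMass_density hsymm n)

/-- Almost invariance of `sqMass`, from the `ℓ²` distance of `μ^{*n}` to its translate. The
parameter `t` comes from the bound `|x² - y²| ≤ t / 2 * (x - y)² + (x² + y²) / t`. -/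
theorem sqMass_image_mul_le (hsymm : IsSymmetric μ) (n : ℕ) (g : G) (A : Set G) {t : ℝ}
    (ht : 0 < t) : sqMass μ n ((fun x => g * x) '' A) ≤
      sqMass μ n A + (t * (1 - stepProb μ (2 * n) g / stepProb μ (2 * n) 1) + 2 / t) := by
  have hpos := stepProb_two_mul_one_pos hsymm n
  have h1 := hasSum_sqMass hsymm n ((fun x => g * x) '' A)
  rw [← (Equiv.mulLeft g).hasSum_iff] at h1
  have h2 := hasSum_sqMass hsymm n A
  have h3 := (hasSum_sq_sub_stepProb hsymm n g).mul_left (t / 2 / stepProb μ (2 * n) 1)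
  have h4 := hasSum_sq_stepProb hsymm n
  have h5 := h4
  rw [← (Equiv.mulLeft g).hasSum_iff] at h5
  have h6 := (h5.add h4).mul_left (1 / t / stepProb μ (2 * n) 1)
  have heq : t / 2 / stepProb μ (2 * n) 1 *
      (2 * (stepProb μ (2 * n) 1 - stepProb μ (2 * n) g)) +
      1 / t / stepProb μ (2 * n) 1 * (stepProb μ (2 * n) 1 + stepProb μ (2 * n) 1) =
      t * (1 - stepProb μ (2 * n) g / stepProb μ (2 * n) 1) + 2 / t := by
    field_simp
    ring
  rw [← heq]
  refine hasSum_le (fun h => ?_) h1 (h2.add (h3.add h6))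
  have hmem : g * h ∈ (fun x => g * x) '' A ↔ h ∈ A := by simp
  simp only [Function.comp, Equiv.coe_mulLeft]
  set x := stepProb μ n (g * h)
  set y := stepProb μ n h
  have hb : 0 ≤ t / 2 * (x - y) ^ 2 + 1 / t * (x ^ 2 + y ^ 2) := by positivity
  have hmain : x ^ 2 ≤ y ^ 2 + (t / 2 * (x - y) ^ 2 + 1 / t * (x ^ 2 + y ^ 2)) := by
    have e : t / 2 * (x - y) ^ 2 + 1 / t * (x ^ 2 + y ^ 2) - (x ^ 2 - y ^ 2) =
        ((t * (x - y) - (x + y)) ^ 2 + (x - y) ^ 2) / (2 * t) := by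
      field_simp
      ring
    have : 0 ≤ ((t * (x - y) - (x + y)) ^ 2 + (x - y) ^ 2) / (2 * t) := by positivity
    linarith
  have hfac : t / 2 / stepProb μ (2 * n) 1 * (x - y) ^ 2 +
      1 / t / stepProb μ (2 * n) 1 * (x ^ 2 + y ^ 2) =
      (t / 2 * (x - y) ^ 2 + 1 / t * (x ^ 2 + y ^ 2)) / stepProb μ (2 * n) 1 := by
    field_simp
  rw [hfac]
  by_cases hA : h ∈ A
  · rw [Set.indicator_of_mem (hmem.2 hA), Set.indicator_of_mem hA, ← add_div]
    gcongr
  · rw [Set.indicator_of_notMem (mt hmem.1 hA), Set.indicator_of_notMem hA, zero_add]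
    positivity

/-- The invariant mean is a limit of the measures `sqMass μ n` along an ultrafilter. Letting `n` and
then `t` tend to infinity in `sqMass_image_mul_le` gives its invariance. -/
theorem isAmenableGroup_of_tendsto_returnQuotient (hsymm : IsSymmetric μ)
    (hnd : IsNondegenerate μ) (hap : IsAperiodic μ)
    (hlim : Tendsto (returnQuotient μ) atTop (nhds 1)) : IsAmenableGroup G := by
  have hex : ∀ A : Set G, ∃ y ∈ Set.Icc (0 : ℝ) 1,
      Tendsto (fun n => sqMass μ n A) (hyperfilter ℕ) (nhds y) := fun A =>
    isCompact_Icc.ultrafilter_le_nhds ((hyperfilter ℕ).map fun n => sqMass μ n A)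
      (by
        rw [le_principal_iff]
        exact Filter.mem_map.2 (Eventually.of_forall fun n => sqMass_mem_Icc hsymm n A))
  choose m hm hconv using hex
  have hle : ∀ (g : G) (A : Set G), m ((fun x => g * x) '' A) ≤ m A := by
    intro g A
    have hbound : ∀ t : ℝ, 0 < t → m ((fun x => g * x) '' A) ≤ m A + 2 / t := by
      intro t ht
      have h1 := (tendsto_stepProb_two_mul_div hsymm hnd hap hlim g).mono_left
        Nat.hyperfilter_le_atTop
      have h2 := (hconv A).add (((h1.const_sub 1).const_mul t).add_const (2 / t))
      rw [sub_self, mul_zero, zero_add] at h2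
      exact le_of_tendsto_of_tendsto' (hconv _) h2 fun n => sqMass_image_mul_le hsymm n g A ht
    have hz : Tendsto (fun t : ℝ => m A + 2 / t) atTop (nhds (m A + 0)) :=
      (tendsto_const_nhds.div_atTop tendsto_id).const_add _
    rw [add_zero] at hz
    exact ge_of_tendsto hz ((eventually_gt_atTop 0).mono hbound)
  refine ⟨fun A => ENNReal.ofReal (m A), ?_, fun A B hAB => ?_, fun g A => ?_⟩
  · have h := hconv Set.univ
    simp only [sqMass_univ hsymm] at h
    beta_reduce
    rw [← tendsto_nhds_unique tendsto_const_nhds h, ENNReal.ofReal_one]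
  · have h := (hconv A).add (hconv B)
    simp only [← sqMass_union hsymm _ hAB] at h
    beta_reduce
    rw [tendsto_nhds_unique (hconv _) h, ENNReal.ofReal_add (hm A).1 (hm B).1]
  · refine congrArg ENNReal.ofReal ((hle g A).antisymm ?_)
    have h := hle g⁻¹ ((fun x => g * x) '' A)
    rwa [Set.image_image, show (fun x => g⁻¹ * (g * x)) = id from funext fun x => by simp,
      Set.image_id] at h

/-! ### Exponential decay forces expansion -/

omit [Countable G] [IsProbabilityMeasure μ] in
theorem energy_zero (F : Finset G) : energy μ F 0 = F.card := by
  classical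
  have : ∀ a b : G, stepProb μ 0 (a * b⁻¹) = if a = b then 1 else 0 := by
    intro a b
    split_ifs with h
    · rw [h, mul_inv_cancel, stepProb_zero_one]
    · exact stepProb_zero_of_ne _ (by rwa [Ne, mul_inv_eq_one])
  simp [energy, this]

theorem energy_pos (hsymm : IsSymmetric μ) {F : Finset G} (hF : F.Nonempty) (n : ℕ) :
    0 < energy μ F (2 * n) := by
  refine Finset.sum_pos' (fun a _ => Finset.sum_nonneg fun b _ => stepProb_nonneg _ _ _) ?_
  obtain ⟨a, ha⟩ := hF
  refine ⟨a, ha, Finset.sum_pos' (fun b _ => stepProb_nonneg _ _ _) ⟨a, ha, ?_⟩⟩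
  rw [mul_inv_cancel]
  exact stepProb_two_mul_one_pos hsymm n

/-- Exponential decay of the return probabilities at rate `c` bounds the norm of convolution by
`μ^{*n}` on indicators of finite sets, with no constant lost. -/
theorem energy_le (hsymm : IsSymmetric μ) {c : ℝ} (hc0 : 0 < c)
    (hc : ∀ n, stepProb μ (2 * n) 1 ≤ c ^ n) {F : Finset G} (hF : F.Nonempty) (n : ℕ) :
    energy μ F (2 * n) ≤ c ^ n * F.card := by
  have hcrude : ∀ n, energy μ F (2 * n) ≤ (F.card * F.card : ℝ) * c ^ n := by
    intro n
    calc energy μ F (2 * n) ≤ ∑ a ∈ F, ∑ b ∈ F, c ^ n :=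
          Finset.sum_le_sum fun a _ => Finset.sum_le_sum fun b _ =>
            (stepProb_two_mul_le hsymm n _).trans (hc n)
      _ = (F.card * F.card : ℝ) * c ^ n := by simp [mul_assoc]
  have := le_pow_mul_of_succ_le_mul (s := fun n => energy μ F (2 * n)) hc0.le
    (succ_le_mul_of_logConvex (s := fun n => energy μ F (2 * n)) (energy_pos hsymm hF)
      (energy_logConvex hsymm F) hc0 hcrude) n
  simpa [energy_zero] using this

/-- If the return probabilities decay exponentially, then translating by a suitable finite set `K`
at least doubles every finite set: `μ^{*n} * 1_F` has small `ℓ²` norm, while at least half of its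
`ℓ¹` norm `|F|` sits on `K F`. -/
theorem exists_two_mul_card_le (hsymm : IsSymmetric μ) [DecidableEq G] {c : ℝ} (hc0 : 0 < c)
    (hc1 : c < 1) (hc : ∀ n, stepProb μ (2 * n) 1 ≤ c ^ n) :
    ∃ K : Finset G, ∀ F : Finset G,
      2 * F.card ≤ (F.biUnion fun a => K.image fun k => k * a).card := by
  obtain ⟨n, hn⟩ := exists_pow_lt_of_lt_one (show (0 : ℝ) < 1 / 8 by norm_num) hc1
  obtain ⟨K, hK⟩ := ((hasSum_stepProb μ n).eventually (lt_mem_nhds one_half_lt_one)).exists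
  refine ⟨K, fun F => ?_⟩
  rcases F.eq_empty_or_nonempty with rfl | hF
  · simp
  set T := F.biUnion fun a => K.image fun k => k * a with hT
  have hmass : (F.card : ℝ) / 2 ≤ ∑ g ∈ T, spread μ F n g := by
    simp only [spread]
    rw [Finset.sum_comm]
    calc (F.card : ℝ) / 2 = ∑ a ∈ F, (1 / 2 : ℝ) := by simp [div_eq_mul_inv]
      _ ≤ ∑ a ∈ F, ∑ g ∈ T, stepProb μ n (g * a⁻¹) := Finset.sum_le_sum fun a ha => ?_
    calc (1 / 2 : ℝ) ≤ ∑ k ∈ K, stepProb μ n k := hK.le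
      _ = ∑ g ∈ K.image fun k => k * a, stepProb μ n (g * a⁻¹) := by
          rw [Finset.sum_image fun x _ y _ h => mul_right_cancel h]
          simp
      _ ≤ ∑ g ∈ T, stepProb μ n (g * a⁻¹) :=
          Finset.sum_le_sum_of_subset_of_nonneg
            (Finset.subset_biUnion_of_mem (fun a => K.image fun k => k * a) ha)
            fun _ _ _ => stepProb_nonneg _ _ _
  have hCS : (∑ g ∈ T, spread μ F n g) ^ 2 ≤ T.card * ∑ g ∈ T, spread μ F n g ^ 2 :=
    sq_sum_le_card_mul_sum_sq
  have hE : ∑ g ∈ T, spread μ F n g ^ 2 ≤ c ^ n * F.card := by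
    refine le_trans ?_ (energy_le hsymm hc0 hc hF n)
    have h := hasSum_spread_mul_spread hsymm F n n
    rw [← two_mul] at h
    simpa only [sq] using sum_le_hasSum T (fun g _ => mul_self_nonneg _) h
  have hFpos : (0 : ℝ) < F.card := by exact_mod_cast hF.card_pos
  have h1 : ((F.card : ℝ) / 2) ^ 2 ≤ T.card * (1 / 8 * F.card) :=
    calc ((F.card : ℝ) / 2) ^ 2 ≤ (∑ g ∈ T, spread μ F n g) ^ 2 := by gcongr
      _ ≤ T.card * (c ^ n * F.card) := hCS.trans (by gcongr)
      _ ≤ T.card * (1 / 8 * F.card) := by gcongr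
  have h2 : (2 * F.card : ℝ) * F.card ≤ T.card * F.card := by nlinarith
  exact_mod_cast le_of_mul_le_mul_right h2 hFpos

end RandomWalk

/-! ### Expansion excludes amenability -/

section Amenable

variable {G : Type*} [Group G]

theorem biUnion_eq_sum_of_additive {α ι : Type*} {m : Set α → ENNReal} (h0 : m ∅ = 0)
    (hadd : ∀ A B : Set α, Disjoint A B → m (A ∪ B) = m A + m B) (s : Finset ι) (A : ι → Set α)
    (hd : (s : Set ι).PairwiseDisjoint A) : m (⋃ i ∈ s, A i) = ∑ i ∈ s, m (A i) := by
  classical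
  induction s using Finset.induction_on with
  | empty => simp [h0]
  | insert i s hi ih =>
    rw [Finset.coe_insert, Set.pairwiseDisjoint_insert_of_notMem (by simpa using hi)] at hd
    rw [Finset.set_biUnion_insert, Finset.sum_insert hi, hadd, ih hd.1]
    exact Set.disjoint_iUnion₂_right.2 fun j hj => hd.2 j hj

/-- If left translation by a finite set `K` at least doubles every finite set, then Hall's marriage
theorem gives two injections of `G` with disjoint ranges that move each point by an element of `K`.
Both ranges would have full measure for an invariant mean. -/
theorem not_isAmenableGroup_of_two_mul_card_le [DecidableEq G] (K : Finset G)
    (hK : ∀ F : Finset G, 2 * F.card ≤ (F.biUnion fun a => K.image fun k => k * a).card) :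
    ¬ IsAmenableGroup G := by
  rintro ⟨m, huniv, hadd, hinv⟩
  obtain ⟨f, hf, hfK⟩ := (Finset.all_card_le_biUnion_card_iff_exists_injective
    fun x : G × Bool => K.image fun k => k * x.1).1 (by
      intro s
      have h1 : s.card ≤ (s.image Prod.fst ×ˢ (Finset.univ : Finset Bool)).card :=
        Finset.card_le_card fun x hx => by
          exact Finset.mem_product.2 ⟨Finset.mem_image_of_mem _ hx, Finset.mem_univ _⟩
      rw [Finset.card_product, Finset.card_univ, Fintype.card_bool, mul_comm] at h1
      refine h1.trans ((hK _).trans_eq ?_)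
      rw [Finset.image_biUnion])
  have h0 : m ∅ = 0 := by
    have h := hadd Set.univ ∅ (by simp)
    rw [Set.union_empty, huniv] at h
    exact (ENNReal.add_right_inj ENNReal.one_ne_top).1 (by rw [← h, add_zero])
  -- the pieces on which the injection `f (·, b)` is translation by `k`
  let A : G × Bool → Set G := fun x => {g | f (g, x.2) = x.1 * g}
  have hmemA : ∀ k b g, g ∈ A (k, b) ↔ f (g, b) = k * g := fun _ _ _ => Iff.rfl
  have hpiece : ∀ b, ∑ k ∈ K, m (A (k, b)) = 1 := by
    intro b
    rw [← biUnion_eq_sum_of_additive h0 hadd K (fun k => A (k, b)), ← huniv]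
    · congr 1
      refine Set.eq_univ_of_forall fun g => ?_
      obtain ⟨k, hk, hkg⟩ := Finset.mem_image.1 (hfK (g, b))
      exact Set.mem_biUnion hk hkg.symm
    · intro k _ l _ hkl
      refine Set.disjoint_left.2 fun g hg hg' => hkl ?_
      rw [hmemA] at hg hg'
      exact mul_right_cancel (hg.symm.trans hg')
  have hdisj : ((K ×ˢ (Finset.univ : Finset Bool) : Finset (G × Bool)) :
      Set (G × Bool)).PairwiseDisjoint fun x => (fun y => x.1 * y) '' A x := by
    rintro ⟨k, b⟩ - ⟨l, b'⟩ - hne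
    refine Set.disjoint_left.2 ?_
    rintro _ ⟨g, hg, rfl⟩ ⟨g', hg', heq⟩
    rw [hmemA] at hg hg'
    simp only at heq
    have h := hf (hg'.trans (heq.trans hg.symm))
    rw [Prod.mk.injEq] at h
    obtain ⟨rfl, rfl⟩ := h
    exact hne (by rw [mul_right_cancel heq])
  have htotal := biUnion_eq_sum_of_additive h0 hadd _ _ hdisj
  simp only [hinv] at htotal
  rw [Finset.sum_product_right] at htotal
  simp only [hpiece] at htotal
  have hle : ∀ B : Set G, m B ≤ 1 := fun B => by
    rw [← huniv, ← Set.union_compl_self B, hadd _ _ disjoint_compl_right]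
    exact le_self_add
  have h2 := hle (⋃ x ∈ K ×ˢ (Finset.univ : Finset Bool), (fun y => x.1 * y) '' A x)
  rw [htotal] at h2
  norm_num at h2

end Amenable

/-! ### The equivalence -/

theorem RandomWalk.tendsto_returnQuotient_of_isAmenableGroup {G : Type*} [Group G]
    [MeasurableSpace G] [DiscreteMeasurableSpace G] [Countable G] {μ : Measure G}
    [IsProbabilityMeasure μ] (hsymm : IsSymmetric μ) (hG : IsAmenableGroup G) :
    Tendsto (returnQuotient μ) atTop (nhds 1) := by
  classical
  refine (tendsto_returnQuotient_or_exists_le_pow hsymm).resolve_right ?_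
  rintro ⟨c, hc0, hc1, hc⟩
  obtain ⟨K, hK⟩ := exists_two_mul_card_le hsymm hc0 hc1 hc
  exact not_isAmenableGroup_of_two_mul_card_le K hK hG

theorem mainTheorem9 {G : Type*} [Group G] [MeasurableSpace G] [DiscreteMeasurableSpace G]
    (S : Set G) (hS : S.Finite) (hgen : Subgroup.closure S = ⊤)
    (μ : Measure G) [IsProbabilityMeasure μ]
    (hsymm : RandomWalk.IsSymmetric μ) (hnd : RandomWalk.IsNondegenerate μ)
    (hap : RandomWalk.IsAperiodic μ) :
    List.TFAE [
      ∃ r : ℕ → ℝ, Tendsto r atTop atTop ∧ RandomWalk.AlmostConstant S μ r,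
      ∃ r : ℕ → ℝ, Tendsto r atTop atTop ∧ RandomWalk.WeaklyAlmostConstant S μ r,
      IsAmenableGroup G] := by
  have := RandomWalk.countable_of_closure_eq_top hS hgen
  tfae_have 1 → 2 := by
    rintro ⟨r, hr, h⟩
    refine ⟨r, hr, 2, two_pos, ?_⟩
    filter_upwards [h (1 / 2) one_half_pos] with n hn g hg
    have := abs_le.1 (hn g hg)
    constructor <;> linarith
  tfae_have 2 → 3 := by
    rintro ⟨r, hr, h⟩
    exact RandomWalk.isAmenableGroup_of_tendsto_returnQuotient hsymm hnd hap
      (RandomWalk.tendsto_returnQuotient_of_weaklyAlmostConstant hsymm hr h)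
  tfae_have 3 → 1 := fun h =>
    RandomWalk.exists_almostConstant (RandomWalk.finite_setOf_wordLength_le hS hgen)
      (RandomWalk.tendsto_ratio hsymm hnd hap
        (RandomWalk.tendsto_returnQuotient_of_isAmenableGroup hsymm h))
  tfae_finish
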